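/- Let $C=\{0,1,2,\dots\}\cup\{\aleph_0,2^{\aleph_0}\}$, and let $S_f$ be the set of all functions $\alpha:\{1,2,\dots,\omega\}\to\{0,1,\dots,\omega\}$ that are not constantly zero, with the subspace topology of the product of discrete spaces (a Polish space, homeomorphic to Baire space). An equivalence relation on a standard Borel space is smooth if it admits a Borel reduction to the equality relation of a standard Borel space, and countable if all its classes are countable. For smooth countable equivalence relations $E\subseteq F$ on a standard Borel space, the local fine shape of an $F$-class $D$ is the function $m\mapsto$ (number of $E$-classes of size $m$ contained in $D$), $1\le m\le\omega$, and the global fine shape of $(E,F)$ is the function that maps $\alpha\in S_f$ to the number of $F$-classes of local fine shape $\alpha$. For a Borel function $g:X\to S_f$ on a standard Borel space $X$, put $\hat g(\alpha)=|g^{-1}(\{\alpha\})|$ for $\alpha \in S_f$. Global fine shapes of pairs of smooth countable equivalence relations and the functions $\hat g$ take values in $C$, and the following hold. (a) A function $\varphi:S_f\to C$ is the global fine shape of some pair $E\subseteq F$ of smooth countable equivalence relations on a standard Borel space if and only if there are a standard Borel space $X$ and a Borel function $g:X\to S_f$ such that $\varphi=\hat g$. (b) Let $X$ be a standard Borel space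 and $g:X\to S_f$ a Borel function. Let $B_g$ be the set of all $(x,k,m,n)\in X\times\mathbb N^3$ such that either $n=0$ and $m<g(x)(\omega)$, or $k<n$ and $m<g(x)(n)$. For $(x,k,m,n)$ and $(x',k',m',n')$ in $B_g$, let them be $F_g$-equivalent iff $x=x'$, and $E_g$-equivalent iff $x=x'$, $m=m'$ and $n=n'$. Then $B_g$ is a Borel subset of $X\times\mathbb N^3$, $E_g\subseteq F_g$ are smooth countable equivalence relations on $B_g$, and the global fine shape of $(E_g,F_g)$ is $\hat g$. -/

import Mathlib

universe u

namespace FineShape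

open Cardinal

/-- The sizes `1, 2, 3, …, ω` of nonempty countable sets; `⊤` stands for `ω`. -/
abbrev Size : Type := {m : ℕ∞ // m ≠ 0}

/-- The set `{0, 1, 2, …} ∪ {ℵ₀, 2^ℵ₀}` of cardinals. -/
def cardC : Set Cardinal.{u} := {κ | κ < ℵ₀} ∪ {ℵ₀, 𝔠}

/-- The space of local fine shapes: all functions from `{1, 2, …, ω}` to `{0, 1, …, ω}` that are
not constantly zero. -/
def Sf : Type := {α : Size → ℕ∞ // α ≠ fun _ => 0}

/-- The topology of `Sf`: the subspace topology of the product of copies of `{0, 1, …, ω}`, each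
copy being discrete (`⊥` is the discrete topology, not the order topology of `ℕ∞`). -/
instance : TopologicalSpace Sf :=
  TopologicalSpace.induced (fun α : Sf => α.1) (@Pi.topologicalSpace Size (fun _ => ℕ∞) fun _ => ⊥)

instance : MeasurableSpace Sf := borel Sf

instance : BorelSpace Sf := ⟨rfl⟩

/-- Smoothness: there is a Borel reduction to the equality relation of a standard Borel space. -/
def IsSmooth {X : Type u} [MeasurableSpace X] (E : Setoid X) : Prop :=
  ∃ (Z : Type u) (_ : MeasurableSpace Z) (_ : StandardBorelSpace Z) (f : X → Z),
    Measurable f ∧ ∀ x y, E x y ↔ f x = f y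

/-- All equivalence classes are countable. -/
def IsCountable {X : Type u} (E : Setoid X) : Prop := ∀ C ∈ E.classes, C.Countable

/-- `E ⊆ F` is a pair of smooth countable equivalence relations (on a standard Borel space `X`). -/
structure IsSmoothCountablePair {X : Type u} [MeasurableSpace X] (E F : Setoid X) : Prop where
  le : E ≤ F
  smooth_left : IsSmooth E
  smooth_right : IsSmooth F
  countable_left : IsCountable E
  countable_right : IsCountable F

/-- The restriction of `E` to the set `A`. -/
abbrev restrict {X : Type u} (E : Setoid X) (A : Set X) : Setoid A := E.comap Subtype.val

/-- The number of `E`-classes of size `m` (`⊤` if there are infinitely many), for an equivalence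
relation `E` on a countable set. -/
noncomputable def numClasses {X : Type u} (E : Setoid X) (m : ℕ∞) : ℕ∞ :=
  {D | D ∈ E.classes ∧ D.encard = m}.encard

/-- The local fine shape `m ↦ n_m(E ↾ C)`, `1 ≤ m ≤ ω`, of a countable set `C`. -/
noncomputable def localShape {X : Type u} (E : Setoid X) (C : Set X) : Size → ℕ∞ :=
  fun m => numClasses (restrict E C) m.1

/-- The global fine shape of `(E, F)`: the number of `F`-classes `C` of local fine shape `α`. -/
noncomputable def globalShape {X : Type u} (E F : Setoid X) (α : Sf) : Cardinal.{u} :=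
  #{C : Set X // C ∈ F.classes ∧ localShape E C = α.1}

/-- The fiber-counting function of `g`. -/
noncomputable def fiberCount {X : Type u} {Y : Type} (g : X → Y) (y : Y) : Cardinal.{u} :=
  #(g ⁻¹' {y})

/-- The set `B_g` of all `(x, k, m, n)` such that either `n = 0` and `m < g(x)(ω)`, or
`k < n` and `m < g(x)(n)`. -/
def canonSet {X : Type u} (g : X → Sf) : Set (X × ℕ × ℕ × ℕ) :=
  {p | (p.2.2.2 = 0 ∧ (p.2.2.1 : ℕ∞) < (g p.1).1 ⟨⊤, ENat.top_ne_zero⟩) ∨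
    ∃ h : p.2.1 < p.2.2.2,
      (p.2.2.1 : ℕ∞) < (g p.1).1 ⟨(p.2.2.2 : ℕ∞), Nat.cast_ne_zero.mpr (Nat.ne_zero_of_lt h)⟩}

/-- `E_g`: the points `(x, k, m, n)` and `(x', k', m', n')` of `B_g` are equivalent iff
`x = x'`, `m = m'` and `n = n'`. -/
def canonE {X : Type u} (g : X → Sf) : Setoid (canonSet g) :=
  restrict (Setoid.ker fun p : X × ℕ × ℕ × ℕ => (p.1, p.2.2.1, p.2.2.2)) (canonSet g)

/-- `F_g`: the points `(x, k, m, n)` and `(x', k', m', n')` of `B_g` are equivalent iff `x = x'`. -/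
def canonF {X : Type u} (g : X → Sf) : Setoid (canonSet g) :=
  restrict (Setoid.ker fun p : X × ℕ × ℕ × ℕ => p.1) (canonSet g)

end FineShape

/-! A smooth pair is determined, as far as its shape is concerned, by the map sending each `F`-class
to its local shape. Reductions of `E` and `F` are countable-to-one Borel maps, so Lusin–Novikov
gives Borel transversals `S` and `T` and makes fiber counting Borel. The local shape at `t ∈ T`
counts the points of `S` in the class of `t` whose `E`-class has a given size; this is a Borel map
`T → Sf`, and its fiber counts form the global shape (`IsSmoothCountablePair.exists_fiberCount`).
Conversely, `globalShape_canon` reads the shape off `B_g`, where `x` names the `F`-class, `(m, n)`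
an `E`-class in it, and `k` a point of that class. Values lie in `cardC` because Borel fibers are
standard Borel.

Lusin–Novikov (`sigmaInjOn_univ`) is proved by a fusion argument: if the source of a continuous map
is not a countable union of Borel sets of injectivity, points of a single fiber can be split again
and again, and in the limit the fiber contains a nonempty perfect set. -/

namespace FineShape

open Set Filter Topology MeasureTheory

/-! ### The Lusin–Novikov theorem -/

section LusinNovikov

/-- `B` is a countable union of measurable sets on which `f` is injective. -/
def SigmaInjOn {Y Z : Type*} [MeasurableSpace Y] (f : Y → Z) (B : Set Y) : Prop :=
  ∃ A : ℕ → Set Y, (∀ n, MeasurableSet (A n) ∧ InjOn f (A n)) ∧ B = ⋃ n, A n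

theorem analyticSet_inter {α : Type*} [TopologicalSpace α] [T2Space α] {s t : Set α}
    (hs : AnalyticSet s) (ht : AnalyticSet t) : AnalyticSet (s ∩ t) := by
  rw [inter_eq_iInter]
  exact AnalyticSet.iInter (by rintro (_ | _) <;> assumption)

section Ideal

variable {Y Z : Type*} [MeasurableSpace Y] {f : Y → Z}

theorem SigmaInjOn.measurableSet {B : Set Y} (h : SigmaInjOn f B) : MeasurableSet B := by
  obtain ⟨A, hA, rfl⟩ := h
  exact MeasurableSet.iUnion fun n => (hA n).1

theorem SigmaInjOn.of_injOn {B : Set Y} (hB : MeasurableSet B) (hf : InjOn f B) :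
    SigmaInjOn f B :=
  ⟨fun _ => B, fun _ => ⟨hB, hf⟩, (iUnion_const B).symm⟩

theorem SigmaInjOn.iUnion {ι : Type*} [Countable ι] {B : ι → Set Y}
    (h : ∀ i, SigmaInjOn f (B i)) : SigmaInjOn f (⋃ i, B i) := by
  rcases isEmpty_or_nonempty ι with hι | hι
  · exact ⟨fun _ => ∅, fun _ => ⟨MeasurableSet.empty, injOn_empty f⟩, by simp⟩
  choose A hA hBA using h
  obtain ⟨e, he⟩ := exists_surjective_nat (ι × ℕ)
  refine ⟨fun n => A (e n).1 (e n).2, fun n => hA _ _, ?_⟩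
  rw [he.iUnion_comp (fun p : ι × ℕ => A p.1 p.2), iUnion_prod']
  exact iUnion_congr hBA

theorem SigmaInjOn.union {B C : Set Y} (hB : SigmaInjOn f B) (hC : SigmaInjOn f C) :
    SigmaInjOn f (B ∪ C) := by
  rw [union_eq_iUnion]
  exact SigmaInjOn.iUnion (by rintro (_ | _) <;> assumption)

/-- The set `H` of sequences is not covered by the sequences that meet, at one of their first `n`
places, a given countable union of measurable sets on which `f` is injective. -/
def Large (f : Y → Z) (n : ℕ) (H : Set (ℕ → Y)) : Prop :=
  ∀ B, SigmaInjOn f B → ∃ γ ∈ H, ∀ j < n, γ j ∉ B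

/-- If every piece failed, the union of the countably many sets witnessing this would be σ-injective
again and would defeat `H`. -/
theorem Large.exists_of_subset_iUnion {ι : Type*} [Countable ι] {n : ℕ} {H : Set (ℕ → Y)}
    {K : ι → Set (ℕ → Y)} (h : Large f n H) (hK : H ⊆ ⋃ i, K i) : ∃ i, Large f n (K i) := by
  by_contra hcon
  simp only [Large, not_exists, not_forall, exists_prop] at hcon
  choose B hB hBK using hcon
  obtain ⟨γ, hγ, hγB⟩ := h _ (SigmaInjOn.iUnion hB)
  obtain ⟨i, hi⟩ := mem_iUnion.1 (hK hγ)
  exact hBK i γ ⟨hi, fun j hj hjB => hγB j hj (mem_iUnion.2 ⟨i, hjB⟩)⟩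

end Ideal

/-- The sequences obtained from `γ ∈ H` by writing at place `n` the `i`-th entry of some `γ' ∈ H`,
when this entry is different from that of `γ` and has the same image under `f`. -/
def extendSet {Y Z : Type*} (f : Y → Z) (n i : ℕ) (H : Set (ℕ → Y)) : Set (ℕ → Y) :=
  (fun p : (ℕ → Y) × (ℕ → Y) => Function.update p.1 n (p.2 i)) ''
    {p | p.1 ∈ H ∧ p.2 ∈ H ∧ f (p.1 i) = f (p.2 i) ∧ p.1 i ≠ p.2 i}

theorem analyticSet_extendSet {Y Z : Type*} [TopologicalSpace Y] [PolishSpace Y]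
    [TopologicalSpace Z] [T2Space Z] {f : Y → Z} (hf : Continuous f) (n i : ℕ) {H : Set (ℕ → Y)}
    (hH : AnalyticSet H) : AnalyticSet (extendSet f n i H) := by
  refine AnalyticSet.image_of_continuous ?_ (by fun_prop)
  have h1 : IsClosed {p : (ℕ → Y) × (ℕ → Y) | f (p.1 i) = f (p.2 i)} :=
    isClosed_eq (by fun_prop) (by fun_prop)
  have h2 : IsOpen {p : (ℕ → Y) × (ℕ → Y) | p.1 i ≠ p.2 i} :=
    isOpen_ne_fun (by fun_prop) (by fun_prop)
  exact analyticSet_inter (hH.preimage continuous_fst)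
    (analyticSet_inter (hH.preimage continuous_snd) (analyticSet_inter h1.analyticSet (by
      borelize ((ℕ → Y) × (ℕ → Y))
      exact h2.measurableSet.analyticSet)))

section Polish

variable {Y Z : Type*} [TopologicalSpace Y] [PolishSpace Y] [MeasurableSpace Y] [BorelSpace Y]
  [TopologicalSpace Z] [T2Space Z] [MeasurableSpace Z] [BorelSpace Z] {f : Y → Z}

/-- An analytic set on which a continuous function is injective has a Borel hull on which the
function is injective. -/
theorem exists_measurable_superset_injOn (hf : Continuous f) {A : Set Y} (hA : AnalyticSet A)
    (hinj : InjOn f A) : ∃ B, A ⊆ B ∧ MeasurableSet B ∧ InjOn f B := by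
  obtain ⟨b, hbc, -, hb⟩ := TopologicalSpace.exists_countable_basis Y
  -- Injectivity on `A` makes the images of disjoint pieces disjoint analytic sets, so a Borel set
  -- `S` separates them. The hull keeps the points that respect all these countably many
  -- separations; two of its points in disjoint `V` and `W` have images on different sides of `S`.
  have hsep : ∀ V W : Set Y, V ∈ b → W ∈ b → Disjoint V W →
      MeasurablySeparable (f '' (A ∩ V)) (f '' (A ∩ W)) := by
    intro V W hV hW hVW
    refine AnalyticSet.measurablySeparable ?_ ?_ ?_
    · exact (analyticSet_inter hA (hb.isOpen hV).measurableSet.analyticSet).image_of_continuous hf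
    · exact (analyticSet_inter hA (hb.isOpen hW).measurableSet.analyticSet).image_of_continuous hf
    · exact Disjoint.image (hVW.mono inter_subset_right inter_subset_right) hinj
        inter_subset_left inter_subset_left
  choose! S hS hS' hSm using hsep
  have : Countable b := hbc.to_subtype
  refine ⟨⋂ (V : b) (W : b) (_ : Disjoint V.1 W.1),
    (V.1ᶜ ∪ f ⁻¹' S V.1 W.1) ∩ (W.1ᶜ ∪ (f ⁻¹' S V.1 W.1)ᶜ), ?_, ?_, ?_⟩
  · intro y hy
    simp only [mem_iInter]
    intro V W hVW
    refine ⟨?_, ?_⟩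
    · by_cases hyV : y ∈ V.1
      · exact Or.inr (hS _ _ V.2 W.2 hVW (mem_image_of_mem f ⟨hy, hyV⟩))
      · exact Or.inl hyV
    · by_cases hyW : y ∈ W.1
      · exact Or.inr fun h =>
          (hS' _ _ V.2 W.2 hVW).le_bot ⟨mem_image_of_mem f ⟨hy, hyW⟩, h⟩
      · exact Or.inl hyW
  · refine MeasurableSet.iInter fun V => MeasurableSet.iInter fun W => MeasurableSet.iInter fun h =>
      ?_
    have h1 := hf.measurable (hSm _ _ V.2 W.2 h)
    exact ((hb.isOpen V.2).measurableSet.compl.union h1).inter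
      ((hb.isOpen W.2).measurableSet.compl.union h1.compl)
  · intro y hy y' hy' hyy'
    by_contra hne
    obtain ⟨V', W', hV', hW', hyV', hyW', hd⟩ := t2_separation hne
    obtain ⟨V, hV, hyV, hVV'⟩ := hb.exists_subset_of_mem_open hyV' hV'
    obtain ⟨W, hW, hyW, hWW'⟩ := hb.exists_subset_of_mem_open hyW' hW'
    simp only [mem_iInter] at hy hy'
    have hVW := hd.mono hVV' hWW'
    have h1 := (hy ⟨V, hV⟩ ⟨W, hW⟩ hVW).1
    have h2 := (hy' ⟨V, hV⟩ ⟨W, hW⟩ hVW).2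
    simp only [mem_union, mem_compl_iff, hyV, hyW, not_true_eq_false, false_or, mem_preimage,
      ← hyy'] at h1 h2
    exact h2 h1

/-- If `B` defeats the extension, then `f` is injective on the `i`-th entries of the sequences in
`H` that avoid `B`. A Borel hull of this analytic set, added to `B`, defeats `H`. -/
theorem large_extendSet (hf : Continuous f) {n i : ℕ} (hi : i < n) {H : Set (ℕ → Y)}
    (hH : AnalyticSet H) (hl : Large f n H) : Large f (n + 1) (extendSet f n i H) := by
  intro B hB
  by_contra hcon
  have hA : AnalyticSet ((fun γ : ℕ → Y => γ i) '' (H ∩ {γ | ∀ j < n, γ j ∉ B})) := by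
    refine AnalyticSet.image_of_continuous (analyticSet_inter hH ?_) (continuous_apply i)
    have : {γ : ℕ → Y | ∀ j < n, γ j ∉ B} = ⋂ j ∈ Iio n, (fun γ : ℕ → Y => γ j) ⁻¹' Bᶜ := by
      ext; simp
    rw [this]
    refine MeasurableSet.analyticSet ?_
    exact MeasurableSet.biInter (to_countable _) fun j _ =>
      measurable_pi_apply j hB.measurableSet.compl
  obtain ⟨B', hAB, hBm, hB'⟩ := exists_measurable_superset_injOn hf hA (by
    rintro _ ⟨γ, ⟨hγ, hγB⟩, rfl⟩ _ ⟨γ', ⟨hγ', hγB'⟩, rfl⟩ heq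
    by_contra hne
    refine hcon ⟨_, ⟨(γ, γ'), ⟨hγ, hγ', heq, hne⟩, rfl⟩, fun j hj => ?_⟩
    rcases (Nat.lt_succ_iff_lt_or_eq.1 hj) with h | rfl
    · simpa [h.ne] using hγB j h
    · simpa using hγB' i hi)
  obtain ⟨γ, hγ, hγB⟩ := hl _ (hB.union (SigmaInjOn.of_injOn hBm hB'))
  exact hγB i hi (Or.inr (hAB ⟨γ, ⟨hγ, fun j hj h => hγB j hj (Or.inl h)⟩, rfl⟩))

end Polish

section Metric

variable {Y Z : Type*} [MetricSpace Y] [CompleteSpace Y] [SecondCountableTopology Y]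
  [MeasurableSpace Y] {f : Y → Z}

theorem Large.exists_small {n : ℕ} {H : Set (ℕ → Y)} (hH : AnalyticSet H) (hl : Large f n H)
    {ε : ℝ} (hε : 0 < ε) : ∃ K ⊆ H, AnalyticSet K ∧ Large f n K ∧
      ∀ γ ∈ K, ∀ γ' ∈ K, ∀ j < n, dist (γ j) (γ' j) ≤ ε := by
  rcases isEmpty_or_nonempty Y with hY | hY
  · exact ⟨H, Subset.rfl, hH, hl, fun γ => (hY.false (γ 0)).elim⟩
  let d := TopologicalSpace.denseSeq Y
  obtain ⟨t, ht⟩ := hl.exists_of_subset_iUnion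
    (K := fun t : Fin n → ℕ => H ∩ ⋂ j : Fin n, {γ | dist (γ j) (d (t j)) ≤ ε / 2}) (by
      intro γ hγ
      have : ∀ j : Fin n, ∃ k, dist (γ j) (d k) ≤ ε / 2 := fun j => by
        obtain ⟨k, hk⟩ := (TopologicalSpace.denseRange_denseSeq Y).exists_dist_lt (γ j)
          (half_pos hε)
        exact ⟨k, hk.le⟩
      choose t ht using this
      exact mem_iUnion.2 ⟨t, hγ, mem_iInter.2 ht⟩)
  refine ⟨_, inter_subset_left, analyticSet_inter hH ?_, ht, ?_⟩
  · exact (isClosed_iInter fun j =>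
      isClosed_le (by fun_prop) continuous_const).analyticSet
  · intro γ hγ γ' hγ' j hj
    have h1 := mem_iInter.1 hγ.2 ⟨j, hj⟩
    have h2 := mem_iInter.1 hγ'.2 ⟨j, hj⟩
    simp only [mem_ofPred_eq] at h1 h2
    linarith [dist_triangle_right (γ j) (γ' j) (d (t ⟨j, hj⟩))]

/-- A uniform gap, unlike mere distinctness, survives the passage to limits. -/
theorem Large.exists_separated {n i k : ℕ} {H : Set (ℕ → Y)} (hH : AnalyticSet H)
    (hl : Large f n H) (hne : ∀ γ ∈ H, γ i ≠ γ k) :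
    ∃ K ⊆ H, AnalyticSet K ∧ Large f n K ∧ ∃ c > 0, ∀ γ ∈ K, c ≤ dist (γ i) (γ k) := by
  obtain ⟨m, hm⟩ := hl.exists_of_subset_iUnion
    (K := fun m : ℕ => H ∩ {γ | 1 / ((m : ℝ) + 1) ≤ dist (γ i) (γ k)}) (by
      intro γ hγ
      obtain ⟨m, hm⟩ := exists_nat_one_div_lt (dist_pos.2 (hne γ hγ))
      exact mem_iUnion.2 ⟨m, hγ, hm.le⟩)
  refine ⟨_, inter_subset_left, analyticSet_inter hH ?_, hm, 1 / ((m : ℝ) + 1), by positivity,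
    fun γ hγ => hγ.2⟩
  exact (isClosed_le continuous_const (by fun_prop)).analyticSet

/-- The invariant of the construction of a perfect subset of a fiber. -/
structure Stage (f : Y → Z) (n : ℕ) (H : Set (ℕ → Y)) : Prop where
  analytic : AnalyticSet H
  large : Large f (n + 1) H
  fiber : ∀ γ ∈ H, ∀ j ≤ n, f (γ j) = f (γ 0)
  small : ∀ γ ∈ H, ∀ γ' ∈ H, ∀ j ≤ n, dist (γ j) (γ' j) ≤ (1 / 2) ^ n

/-- The relation between consecutive steps of the construction of a perfect subset of a fiber. -/
structure StageStep (n i : ℕ) (H K : Set (ℕ → Y)) : Prop where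
  extend : ∀ δ ∈ K, ∃ γ ∈ H, ∀ j ≤ n, δ j = γ j
  double : ∀ δ ∈ K, ∃ γ ∈ H, δ (n + 1) = γ i
  separate : ∃ c > 0, ∀ δ ∈ K, c ≤ dist (δ (n + 1)) (δ i)

theorem exists_stage_zero (h : ¬ SigmaInjOn f univ) : ∃ H, Stage f 0 H := by
  have hl : Large f 1 univ := by
    intro B hB
    have : ∃ y, y ∉ B := by
      by_contra! hcon
      exact h (eq_univ_of_forall hcon ▸ hB)
    obtain ⟨y, hy⟩ := this
    exact ⟨fun _ => y, mem_univ _, fun _ _ => hy⟩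
  obtain ⟨K, -, hK, hKl, hKs⟩ := hl.exists_small isClosed_univ.analyticSet one_pos
  exact ⟨K, hK, hKl, by simp, fun γ hγ γ' hγ' j hj => by
    simpa using hKs γ hγ γ' hγ' j (by omega)⟩

variable [BorelSpace Y] [TopologicalSpace Z] [T2Space Z] [MeasurableSpace Z] [BorelSpace Z]

theorem Stage.exists_next (hf : Continuous f) {n i : ℕ} (hi : i ≤ n) {H : Set (ℕ → Y)}
    (hH : Stage f n H) : ∃ K, Stage f (n + 1) K ∧ StageStep n i H K := by
  have hin : i ≠ n + 1 := by omega
  have hext : ∀ δ ∈ extendSet f (n + 1) i H, ∃ γ ∈ H, ∃ γ' ∈ H, (∀ j ≤ n, δ j = γ j) ∧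
      δ (n + 1) = γ' i ∧ f (γ i) = f (γ' i) ∧ γ i ≠ γ' i := by
    rintro _ ⟨⟨γ, γ'⟩, ⟨hγ, hγ', heq, hne⟩, rfl⟩
    refine ⟨γ, hγ, γ', hγ', fun j hj => ?_, by simp, heq, hne⟩
    simp [show j ≠ n + 1 by omega]
  obtain ⟨K₁, hK₁H, hK₁, hK₁l, c, hc, hK₁c⟩ :=
    (large_extendSet hf (Nat.lt_succ_of_le hi) hH.analytic hH.large).exists_separated
      (i := n + 1) (k := i) (analyticSet_extendSet hf _ _ hH.analytic) (by
        intro δ hδ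
        obtain ⟨γ, -, γ', -, h1, h2, -, hne⟩ := hext δ hδ
        rw [h1 i hi, h2]
        exact hne.symm)
  obtain ⟨K, hKK₁, hK, hKl, hKs⟩ := hK₁l.exists_small hK₁
    (ε := (1 / 2) ^ (n + 1)) (by positivity)
  refine ⟨K, ⟨hK, hKl, ?_, fun γ hγ γ' hγ' j hj => hKs γ hγ γ' hγ' j (by omega)⟩, ?_, ?_, c, hc,
    fun δ hδ => hK₁c δ (hKK₁ hδ)⟩
  · intro δ hδ j hj
    obtain ⟨γ, hγ, γ', hγ', h1, h2, heq, -⟩ := hext δ (hK₁H (hKK₁ hδ))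
    rw [h1 0 (Nat.zero_le n)]
    rcases Nat.le_succ_iff.1 hj with h | rfl
    · rw [h1 j h, hH.fiber γ hγ j h]
    · rw [h2, ← heq, hH.fiber γ hγ i hi]
  · intro δ hδ
    obtain ⟨γ, hγ, γ', hγ', h1, h2, heq, -⟩ := hext δ (hK₁H (hKK₁ hδ))
    exact ⟨γ, hγ, h1⟩
  · intro δ hδ
    obtain ⟨γ, hγ, γ', hγ', h1, h2, heq, -⟩ := hext δ (hK₁H (hKK₁ hδ))
    exact ⟨γ', hγ', h2⟩

theorem exists_perfect_subset_fiber (hf : Continuous f) (h : ¬ SigmaInjOn f univ) :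
    ∃ (z : Z) (C : Set Y), Perfect C ∧ C.Nonempty ∧ C ⊆ f ⁻¹' {z} := by
  obtain ⟨H₀, hH₀⟩ := exists_stage_zero h
  -- Step `n` splits the point with index `n.unpair.1 ≤ n`, so every index is split infinitely
  -- often.
  have hnext : ∀ (n : ℕ) (H : {H // Stage f n H}), ∃ K : {K // Stage f (n + 1) K},
      StageStep n n.unpair.1 H.1 K.1 := fun n H => by
    obtain ⟨K, hK, hK'⟩ := H.2.exists_next hf (Nat.unpair_left_le n)
    exact ⟨⟨K, hK⟩, hK'⟩
  choose next hnext using hnext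
  let S : ∀ n, {H // Stage f n H} := fun n => Nat.rec ⟨H₀, hH₀⟩ next n
  have hS : ∀ n, StageStep n n.unpair.1 (S n).1 (S (n + 1)).1 := fun n => hnext n (S n)
  have hmem : ∀ n, ∃ γ, γ ∈ (S n).1 := fun n => by
    obtain ⟨γ, hγ, -⟩ := (S n).2.large ∅ (SigmaInjOn.of_injOn MeasurableSet.empty (injOn_empty f))
    exact ⟨γ, hγ⟩
  choose γ hγ using hmem
  have hchain : ∀ n N, n ≤ N → ∀ δ ∈ (S N).1, ∃ δ' ∈ (S n).1, ∀ j ≤ n, δ j = δ' j := by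
    intro n N hN
    induction N, hN using Nat.le_induction with
    | base => exact fun δ hδ => ⟨δ, hδ, fun _ _ => rfl⟩
    | succ N hN ih =>
      intro δ hδ
      obtain ⟨δ₁, hδ₁, h1⟩ := (hS N).extend δ hδ
      obtain ⟨δ₂, hδ₂, h2⟩ := ih δ₁ hδ₁
      exact ⟨δ₂, hδ₂, fun j hj => (h1 j (hj.trans hN)).trans (h2 j hj)⟩
  have hclose : ∀ n N, n ≤ N → ∀ j ≤ n, dist (γ N j) (γ n j) ≤ (1 / 2) ^ n := by
    intro n N hN j hj
    obtain ⟨δ, hδ, h1⟩ := hchain n N hN (γ N) (hγ N)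
    rw [h1 j hj]
    exact (S n).2.small δ hδ (γ n) (hγ n) j hj
  have hpow : ∀ ε > (0 : ℝ), ∃ m : ℕ, ∀ n ≥ m, (1 / 2 : ℝ) ^ n < ε := fun ε hε => by
    obtain ⟨m, hm⟩ := exists_pow_lt_of_lt_one hε (by norm_num : (1 / 2 : ℝ) < 1)
    exact ⟨m, fun n hn =>
      (pow_le_pow_of_le_one (by norm_num) (by norm_num) hn).trans_lt hm⟩
  have hlim : ∀ j, ∃ y, Tendsto (fun n => γ n j) atTop (𝓝 y) := by
    intro j
    refine cauchySeq_tendsto_of_complete (Metric.cauchySeq_iff'.2 fun ε hε => ?_)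
    obtain ⟨m, hm⟩ := hpow ε hε
    exact ⟨max m j, fun n hn =>
      (hclose _ n hn j (le_max_right m j)).trans_lt (hm _ (le_max_left m j))⟩
  choose y hy using hlim
  have hfiber : ∀ j, f (y j) = f (y 0) := fun j => by
    refine tendsto_nhds_unique_of_eventuallyEq ((hf.tendsto _).comp (hy j))
      ((hf.tendsto _).comp (hy 0)) ?_
    filter_upwards [eventually_ge_atTop j] with n hn
    exact (S n).2.fiber (γ n) (hγ n) j hn
  have hne : ∀ n, y (n + 1) ≠ y n.unpair.1 := by
    intro n
    obtain ⟨c, hc, hsep⟩ := (hS n).separate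
    have : c ≤ dist (y (n + 1)) (y n.unpair.1) := by
      refine ge_of_tendsto ((hy (n + 1)).dist (hy n.unpair.1)) ?_
      filter_upwards [eventually_ge_atTop (n + 1)] with N hN
      obtain ⟨δ, hδ, h1⟩ := hchain (n + 1) N hN (γ N) (hγ N)
      rw [h1 _ le_rfl, h1 _ ((Nat.unpair_left_le n).trans n.le_succ)]
      exact hsep δ hδ
    exact dist_pos.1 (hc.trans_le this)
  have hnear : ∀ n, dist (y (n + 1)) (y n.unpair.1) ≤ (1 / 2) ^ n := by
    intro n
    refine le_of_tendsto ((hy (n + 1)).dist (hy n.unpair.1)) ?_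
    filter_upwards [eventually_ge_atTop (n + 1)] with N hN
    obtain ⟨δ, hδ, h1⟩ := hchain (n + 1) N hN (γ N) (hγ N)
    have hi := Nat.unpair_left_le n
    rw [h1 _ le_rfl, h1 _ (hi.trans n.le_succ)]
    obtain ⟨δ₁, hδ₁, h2⟩ := (hS n).double δ hδ
    obtain ⟨δ₂, hδ₂, h3⟩ := (hS n).extend δ hδ
    rw [h2, h3 _ hi]
    exact (S n).2.small _ hδ₁ _ hδ₂ _ hi
  have hperf : Preperfect (range y) := by
    rw [preperfect_iff_nhds]
    rintro _ ⟨k, rfl⟩ U hU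
    obtain ⟨ε, hε, hεU⟩ := Metric.mem_nhds_iff.1 hU
    obtain ⟨m, hm⟩ := hpow ε hε
    -- Step `Nat.pair k m ≥ m` splits the `k`-th point, which puts another limit point within `(1 /
    -- 2) ^ m` of `y k`.
    have hk : (Nat.unpair (Nat.pair k m)).1 = k := by simp
    have h1 := hnear (Nat.pair k m)
    have h2 := hne (Nat.pair k m)
    rw [hk] at h1 h2
    exact ⟨_, ⟨hεU (h1.trans_lt (hm _ (Nat.right_le_pair k m))), mem_range_self _⟩, h2⟩
  refine ⟨f (y 0), closure (range y), hperf.perfect_closure, (range_nonempty y).closure, ?_⟩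
  refine closure_minimal ?_ (isClosed_singleton.preimage hf)
  rintro _ ⟨j, rfl⟩
  exact hfiber j

theorem sigmaInjOn_univ_of_continuous (hf : Continuous f)
    (hc : ∀ z, (f ⁻¹' {z}).Countable) : SigmaInjOn f univ := by
  by_contra h
  obtain ⟨z, C, hC, hne, hCz⟩ := exists_perfect_subset_fiber hf h
  obtain ⟨g, hg, -, hinj⟩ := hC.exists_nat_bool_injection hne
  have h1 : (range g).Countable := (hc z).mono (hg.trans hCz)
  have h2 : Countable (ℕ → Bool) := by
    rw [← countable_univ_iff]
    exact countable_of_injective_of_countable_image hinj.injOn (by rwa [image_univ])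
  have h3 := Cardinal.mk_le_aleph0_iff.2 h2
  simp only [Cardinal.mk_pi, Cardinal.mk_bool, Cardinal.prod_const, Cardinal.lift_id,
    Cardinal.mk_nat] at h3
  exact (Cardinal.cantor Cardinal.aleph0).not_ge h3

end Metric

/-- Lusin–Novikov: the source of a countable-to-one Borel map is a countable union of Borel sets
on which the map is injective. -/
theorem sigmaInjOn_univ {Y Z : Type*} [MeasurableSpace Y] [StandardBorelSpace Y]
    [MeasurableSpace Z] [StandardBorelSpace Z] {f : Y → Z} (hf : Measurable f)
    (hc : ∀ z, (f ⁻¹' {z}).Countable) : SigmaInjOn f univ := by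
  let τ := (upgradeStandardBorel Y).toTopologicalSpace
  have hτ : PolishSpace Y := (upgradeStandardBorel Y).toPolishSpace
  have hτB : BorelSpace Y := (upgradeStandardBorel Y).toBorelSpace
  let := upgradeStandardBorel Z
  -- A finer Polish topology makes `f` continuous and has the same Borel sets.
  obtain ⟨t', hle, hfc, hP⟩ := hf.exists_continuous
  have hB : @BorelSpace Y t' _ := @BorelSpace.mk _ t' _
    (hτB.measurable_eq.trans (@borel_eq_borel_of_le _ t' τ hP hτ hle).symm)
  clear hle
  clear hτB
  clear hτ τ
  let := TopologicalSpace.upgradeIsCompletelyMetrizable Y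
  exact sigmaInjOn_univ_of_continuous hfc hc

end LusinNovikov

/-! ### Borel transversals and fiber counting -/

section CountableToOne

variable {Y Z : Type*} [MeasurableSpace Y] [StandardBorelSpace Y]
    [MeasurableSpace Z] [StandardBorelSpace Z] {f : Y → Z}

/-- Lusin–Novikov: the points of the fibers of a countable-to-one Borel map can be numbered in a
Borel way. -/
theorem exists_measurable_nat_injOn_fiber (hf : Measurable f)
    (hc : ∀ z, (f ⁻¹' {z}).Countable) :
    ∃ ι : Y → ℕ, Measurable ι ∧ ∀ y y', f y = f y' → ι y = ι y' → y = y' := by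
  classical
  obtain ⟨A, hA, hAu⟩ := sigmaInjOn_univ hf hc
  have hex : ∀ y, ∃ n, y ∈ A n := fun y => mem_iUnion.1 (hAu ▸ mem_univ y)
  refine ⟨fun y => Nat.find (hex y), measurable_find hex fun n => (hA n).1,
    fun y y' hff hι => ?_⟩
  have h1 := Nat.find_spec (hex y)
  have h2 := Nat.find_spec (hex y')
  have hι : Nat.find (hex y) = Nat.find (hex y') := hι
  rw [← hι] at h2
  exact (hA _).2 h1 h2 hff

theorem measurableSet_image_of_countable_fiber (hf : Measurable f)
    (hc : ∀ z, (f ⁻¹' {z}).Countable) {S : Set Y} (hS : MeasurableSet S) :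
    MeasurableSet (f '' S) := by
  obtain ⟨ι, hι, hinj⟩ := exists_measurable_nat_injOn_fiber hf hc
  have : f '' S = ⋃ n, f '' (S ∩ ι ⁻¹' {n}) := by
    rw [← image_iUnion, ← inter_iUnion, ← preimage_iUnion, iUnion_of_singleton]
    simp
  rw [this]
  refine MeasurableSet.iUnion fun n => MeasurableSet.image_of_measurable_injOn
    (hS.inter (hι (measurableSet_singleton n))) hf ?_
  rintro y ⟨-, hy⟩ y' ⟨-, hy'⟩ h
  exact hinj y y' h (hy.trans hy'.symm)

/-- A countable-to-one Borel map has a Borel transversal. -/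
theorem exists_measurable_transversal (hf : Measurable f) (hc : ∀ z, (f ⁻¹' {z}).Countable) :
    ∃ T : Set Y, MeasurableSet T ∧ InjOn f T ∧ ∀ y, ∃ t ∈ T, f t = f y := by
  classical
  obtain ⟨ι, hι, hinj⟩ := exists_measurable_nat_injOn_fiber hf hc
  -- The points whose number is least in their fiber.
  refine ⟨⋂ m, {y | ι y ≤ m} ∪ (f ⁻¹' (f '' (ι ⁻¹' {m})))ᶜ, ?_, ?_, ?_⟩
  · refine MeasurableSet.iInter fun m => (measurableSet_le hι measurable_const).union ?_
    exact (hf (measurableSet_image_of_countable_fiber hf hc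
      (hι (measurableSet_singleton m)))).compl
  · have key : ∀ y ∈ ⋂ m, {y | ι y ≤ m} ∪ (f ⁻¹' (f '' (ι ⁻¹' {m})))ᶜ, ∀ y', f y' = f y →
        ι y ≤ ι y' := by
      intro y hy y' hyy'
      rcases mem_iInter.1 hy (ι y') with h | h
      · exact h
      · exact (h ⟨y', rfl, hyy'⟩).elim
    intro y hy y' hy' h
    exact hinj y y' h (le_antisymm (key y hy y' h.symm) (key y' hy' y h))
  · intro y
    have hex : ∃ n, ∃ t, f t = f y ∧ ι t = n := ⟨_, y, rfl, rfl⟩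
    obtain ⟨t, ht, hn⟩ := Nat.find_spec hex
    refine ⟨t, mem_iInter.2 fun m => ?_, ht⟩
    by_cases hm : ι t ≤ m
    · exact Or.inl hm
    · refine Or.inr ?_
      rintro ⟨t', ht', h⟩
      exact Nat.find_min hex (m := m) (by omega) ⟨t', h.trans ht, ht'⟩

/-- Having at least `k` indices is a countable union, over the `k`-element sets of indices, of
finite intersections. -/
theorem measurableSet_encard_eq {X : Type*} [MeasurableSpace X] {P : ℕ → Set X}
    (hP : ∀ n, MeasurableSet (P n)) (k : ℕ∞) : MeasurableSet {x | {n | x ∈ P n}.encard = k} := by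
  have hle : ∀ k : ℕ, MeasurableSet {x | (k : ℕ∞) ≤ {n | x ∈ P n}.encard} := by
    intro k
    have : {x | (k : ℕ∞) ≤ {n | x ∈ P n}.encard} =
        ⋃ (t : Finset ℕ) (_ : t.card = k), ⋂ n ∈ t, P n := by
      ext x
      simp only [mem_ofPred_eq, mem_iUnion, mem_iInter, exists_prop]
      constructor
      · intro h
        obtain ⟨t, ht, htk⟩ := exists_subset_encard_eq h
        have hfin : t.Finite := finite_of_encard_eq_coe htk
        refine ⟨hfin.toFinset, ?_, fun n hn => ht (hfin.mem_toFinset.1 hn)⟩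
        rw [hfin.encard_eq_coe_toFinset_card] at htk
        exact_mod_cast htk
      · rintro ⟨t, rfl, ht⟩
        rw [← encard_coe_eq_coe_finsetCard]
        exact encard_le_encard fun n hn => ht n hn
    rw [this]
    exact MeasurableSet.iUnion fun t => MeasurableSet.iUnion fun _ =>
      MeasurableSet.biInter (to_countable _) fun n _ => hP n
  induction k using ENat.recTopCoe with
  | top =>
    have : {x | {n | x ∈ P n}.encard = ⊤} = ⋂ k : ℕ, {x | (k : ℕ∞) ≤ {n | x ∈ P n}.encard} := by
      ext x
      simp [ENat.eq_top_iff_forall_ge]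
    rw [this]
    exact MeasurableSet.iInter hle
  | coe k =>
    have : {x | {n | x ∈ P n}.encard = k} = {x | (k : ℕ∞) ≤ {n | x ∈ P n}.encard} \
        {x | ((k + 1 : ℕ) : ℕ∞) ≤ {n | x ∈ P n}.encard} := by
      ext x
      simp only [mem_ofPred_eq, Set.mem_sdiff, Nat.cast_add, Nat.cast_one,
        ENat.add_one_le_iff (ENat.natCast_ne_top k), not_lt]
      exact ⟨fun h => ⟨h.ge, h.le⟩, fun h => le_antisymm h.2 h.1⟩
    rw [this]
    exact (hle k).diff (hle (k + 1))

/-- The numbering turns points of a fiber into natural numbers, and the set of `y` whose fiber has a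
point of `S` numbered `n` is Borel. -/
theorem measurableSet_encard_fiber_eq (hf : Measurable f) (hc : ∀ z, (f ⁻¹' {z}).Countable)
    {S : Set Y} (hS : MeasurableSet S) (k : ℕ∞) :
    MeasurableSet {y | {y' | y' ∈ S ∧ f y' = f y}.encard = k} := by
  obtain ⟨ι, hι, hinj⟩ := exists_measurable_nat_injOn_fiber hf hc
  have hP : ∀ n, MeasurableSet (f ⁻¹' (f '' (S ∩ ι ⁻¹' {n}))) := fun n =>
    hf (measurableSet_image_of_countable_fiber hf hc
      (hS.inter (hι (measurableSet_singleton n))))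
  convert! measurableSet_encard_eq hP k using 4 with y
  have hI : InjOn ι {y' | y' ∈ S ∧ f y' = f y} := fun a ha b hb h =>
    hinj a b (ha.2.trans hb.2.symm) h
  rw [← hI.encard_image]
  congr 1
  ext n
  simp only [mem_image, mem_ofPred_eq, mem_preimage, mem_inter_iff, mem_singleton_iff]
  exact ⟨fun ⟨a, ⟨h1, h2⟩, h3⟩ => ⟨a, ⟨h1, h3⟩, h2⟩, fun ⟨a, ⟨h1, h3⟩, h2⟩ => ⟨a, ⟨h1, h2⟩, h3⟩⟩

end CountableToOne

/-! ### Local and global shapes -/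

section Shapes

theorem isOpen_setOf_apply_eq (m : Size) (k : ℕ∞) : IsOpen {α : Sf | α.1 m = k} := by
  let : TopologicalSpace ℕ∞ := ⊥
  have : DiscreteTopology ℕ∞ := ⟨rfl⟩
  exact isOpen_induced_iff.2 ⟨{α | α m = k},
    (isOpen_discrete {k}).preimage (continuous_apply (A := fun _ : Size => ℕ∞) m), rfl⟩

/-- There are only countably many finite patterns of coordinates and values, so each open set is a
countable union of cylinders. -/
theorem measurable_Sf_iff {X : Type*} [MeasurableSpace X] {g : X → Sf} :
    Measurable g ↔ ∀ m k, MeasurableSet {x | (g x).1 m = k} := by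
  refine ⟨fun hg m k => hg (isOpen_setOf_apply_eq m k).measurableSet, fun h => ?_⟩
  refine measurable_of_isOpen fun U hU => ?_
  obtain ⟨V, hV, rfl⟩ := (@isOpen_induced_iff _ _
    (@Pi.topologicalSpace Size (fun _ => ℕ∞) fun _ => ⊥) _ _).1 hU
  have : g ⁻¹' ((fun α : Sf => α.1) ⁻¹' V) =
      ⋃ (p : Σ I : Finset Size, I → ℕ∞) (_ : {α : Size → ℕ∞ | ∀ i : p.1, α i = p.2 i} ⊆ V),
        ⋂ i : p.1, {x | (g x).1 i = p.2 i} := by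
    ext x
    simp only [mem_preimage, mem_iUnion, mem_iInter, mem_ofPred_eq, exists_prop]
    constructor
    · intro hx
      obtain ⟨I, u, hu, hIV⟩ := (@isOpen_pi_iff Size (fun _ => ℕ∞) (fun _ => ⊥) V).1 hV _ hx
      refine ⟨⟨I, fun i => (g x).1 i⟩, fun α hα => hIV fun i hi => ?_, fun i => rfl⟩
      rw [show α i = (g x).1 i from hα ⟨i, hi⟩]
      exact (hu i hi).2
    · rintro ⟨p, hp, hx⟩
      exact hp hx
  rw [this]
  have : Countable ℕ∞ := inferInstanceAs (Countable (Option ℕ))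
  exact MeasurableSet.iUnion fun p => MeasurableSet.iUnion fun _ => MeasurableSet.iInter fun i =>
    h _ _

theorem measurableSet_fiber {X : Type*} [MeasurableSpace X] {g : X → Sf} (hg : Measurable g)
    (α : Sf) : MeasurableSet (g ⁻¹' {α}) := by
  have : g ⁻¹' {α} = ⋂ m, {x | (g x).1 m = α.1 m} := by
    ext x
    simp only [mem_preimage, mem_singleton_iff, mem_iInter, mem_ofPred_eq]
    exact ⟨fun h m => by rw [h], fun h => Subtype.ext (funext h)⟩
  have : Countable ℕ∞ := inferInstanceAs (Countable (Option ℕ))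
  rw [‹g ⁻¹' {α} = _›]
  exact MeasurableSet.iInter fun m => measurable_Sf_iff.1 hg _ _

theorem mk_mem_cardC (X : Type u) [MeasurableSpace X] [StandardBorelSpace X] :
    Cardinal.mk X ∈ cardC := by
  by_cases hX : Countable X
  · rcases (Cardinal.mk_le_aleph0_iff.2 hX).lt_or_eq with h | h
    · exact Or.inl h
    · exact Or.inr (Or.inl h)
  · refine Or.inr (Or.inr ?_)
    have h := Cardinal.mk_congr_lift (PolishSpace.measurableEquivNatBoolOfNotCountable hX).toEquiv
    simpa using h

theorem fiberCount_mem_cardC {X : Type u} [MeasurableSpace X] [StandardBorelSpace X] {g : X → Sf}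
    (hg : Measurable g) (α : Sf) : fiberCount g α ∈ cardC :=
  have := (measurableSet_fiber hg α).standardBorel
  mk_mem_cardC (g ⁻¹' {α})

theorem numClasses_eq {W : Type*} {r : Setoid W} {m : ℕ∞} {J : Set W}
    (hsize : ∀ j ∈ J, {w | r w j}.encard = m) (hinj : ∀ i ∈ J, ∀ j ∈ J, r i j → i = j)
    (hex : ∀ w, {w' | r w' w}.encard = m → ∃ j ∈ J, r w j) : numClasses r m = J.encard := by
  have hI : InjOn (fun j => {w | r w j}) J := by
    intro i hi j hj h
    have : i ∈ {w | r w j} := by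
      rw [← show {w | r w i} = {w | r w j} from h]
      exact r.refl' i
    exact hinj i hi j hj this
  rw [numClasses, ← hI.encard_image]
  congr 1
  ext D
  constructor
  · rintro ⟨⟨w, rfl⟩, hw⟩
    obtain ⟨j, hj, hwj⟩ := hex w hw
    refine ⟨j, hj, ?_⟩
    ext w'
    exact ⟨fun h => r.trans' h (r.symm' hwj), fun h => r.trans' h hwj⟩
  · rintro ⟨j, hj, rfl⟩
    exact ⟨r.mem_classes j, hsize j hj⟩

/-- As `C` is `E`-invariant, restriction does not change the sizes of classes; `J` picks one point
from each class of size `m`. -/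
theorem localShape_eq {W : Type u} {E : Setoid W} {C : Set W} (hC : ∀ x ∈ C, ∀ y, E y x → y ∈ C)
    {m : Size} {J : Set W} (hJ : J ⊆ C) (hsize : ∀ j ∈ J, {w | E w j}.encard = m.1)
    (hinj : ∀ i ∈ J, ∀ j ∈ J, E i j → i = j)
    (hex : ∀ w ∈ C, {w' | E w' w}.encard = m.1 → ∃ j ∈ J, E w j) :
    localShape E C m = J.encard := by
  have hclass : ∀ w : C, {w' : C | restrict E C w' w}.encard = {w' | E w' w}.encard := by
    intro w
    rw [← Subtype.val_injective.injOn.encard_image]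
    congr 1
    ext w'
    constructor
    · rintro ⟨v, hv, rfl⟩
      exact hv
    · intro h
      exact ⟨⟨w', hC w w.2 w' h⟩, h, rfl⟩
  have h := numClasses_eq (r := restrict E C) (m := m.1) (J := Subtype.val ⁻¹' J)
    (fun j hj => (hclass j).trans (hsize j hj))
    (fun i hi j hj h => Subtype.ext (hinj i hi j hj h))
    (fun w hw => by
      obtain ⟨j, hj, hwj⟩ := hex w w.2 ((hclass w).symm.trans hw)
      exact ⟨⟨j, hJ hj⟩, hj, hwj⟩)
  rw [localShape, h, encard_preimage_of_injective_subset_range Subtype.val_injective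
    (by simpa using hJ)]

/-- Used for both directions: `c` is the inclusion of a transversal, or a choice of points in `B_g`.
-/
theorem globalShape_eq_fiberCount {X Y : Type u} {E F : Setoid Y} {g : X → Sf} (c : X → Y)
    (hinj : ∀ x x', F (c x) (c x') → x = x') (hex : ∀ y, ∃ x, F y (c x))
    (hg : ∀ x, localShape E {y | F y (c x)} = (g x).1) (α : Sf) :
    globalShape E F α = fiberCount g α := by
  refine Cardinal.mk_congr (Equiv.ofBijective
    (fun x : g ⁻¹' {α} => (⟨{y | F y (c x)}, F.mem_classes _, (hg x).trans
      (congrArg Subtype.val x.2)⟩ : {C : Set Y // C ∈ F.classes ∧ localShape E C = α.1}))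
    ⟨?_, ?_⟩).symm
  · intro x x' h
    have h : {y | F y (c x)} = {y | F y (c x')} := congrArg Subtype.val h
    have : c x ∈ {y | F y (c x')} := h ▸ F.refl' (c x)
    exact Subtype.ext (hinj _ _ this)
  · rintro ⟨_, ⟨y, rfl⟩, hy⟩
    obtain ⟨x, hx⟩ := hex y
    have hC : {w | F w y} = {w | F w (c x)} := by
      ext w
      exact ⟨fun h => F.trans' h hx, fun h => F.trans' h (F.symm' hx)⟩
    refine ⟨⟨x, Subtype.ext ?_⟩, Subtype.ext hC.symm⟩
    rw [← hg, ← hC, hy]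

theorem IsCountable.countable_fiber {Y Z : Type*} {E : Setoid Y} (hE : IsCountable E) {f : Y → Z}
    (hf : ∀ x y, E x y ↔ f x = f y) (z : Z) : (f ⁻¹' {z}).Countable := by
  by_cases hz : ∃ y, f y = z
  · obtain ⟨y, rfl⟩ := hz
    refine (hE _ (E.mem_classes y)).mono fun x hx => ?_
    exact (hf x y).2 hx
  · convert countable_empty
    exact eq_empty_of_forall_notMem fun y hy => hz ⟨y, hy⟩

/-- The global fine shape of a pair is the fiber-counting function of the Borel function that maps
each point of a Borel transversal of `F` to the local fine shape of its class. -/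
theorem IsSmoothCountablePair.exists_fiberCount {Y : Type u} [MeasurableSpace Y]
    [StandardBorelSpace Y] {E F : Setoid Y} (h : IsSmoothCountablePair E F) :
    ∃ (X : Type u) (_ : MeasurableSpace X) (_ : StandardBorelSpace X) (g : X → Sf),
      Measurable g ∧ ∀ α, globalShape E F α = fiberCount g α := by
  obtain ⟨W, _, _, e, he, hEe⟩ := h.smooth_left
  obtain ⟨Z, _, _, f, hf, hFf⟩ := h.smooth_right
  have hec := h.countable_left.countable_fiber hEe
  have hfc := h.countable_right.countable_fiber hFf
  obtain ⟨S, hS, hSinj, hSex⟩ := exists_measurable_transversal he hec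
  obtain ⟨T, hT, hTinj, hTex⟩ := exists_measurable_transversal hf hfc
  have hsize : ∀ k, MeasurableSet {y | {w | E w y}.encard = k} := fun k => by
    simpa [hEe] using measurableSet_encard_fiber_eq he hec MeasurableSet.univ k
  have hshape : ∀ (m : Size) (y : Y), localShape E {w | F w y} m =
      {w | w ∈ S ∩ {y | {w | E w y}.encard = m.1} ∧ f w = f y}.encard := by
    intro m y
    refine localShape_eq (fun x hx w hw => F.trans' (h.le hw) hx) ?_ ?_ ?_ ?_
    · rintro w ⟨-, hw⟩
      exact (hFf w y).2 hw
    · rintro w ⟨hw, -⟩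
      exact hw.2
    · rintro w ⟨hw, -⟩ w' ⟨hw', -⟩ hww'
      exact hSinj hw.1 hw'.1 ((hEe w w').1 hww')
    · intro w hw hm
      obtain ⟨t, ht, htw⟩ := hSex w
      have hwt : E w t := (hEe w t).2 htw.symm
      refine ⟨t, ⟨⟨ht, ?_⟩, ?_⟩, hwt⟩
      · rw [mem_ofPred_eq, ← hm]
        congr 1
        ext v
        exact ⟨fun h => E.trans' h (E.symm' hwt), fun h => E.trans' h hwt⟩
      · exact (hFf t y).1 (F.trans' (F.symm' (h.le hwt)) hw)
  -- The size of the `E`-class of `y` itself occurs in the shape.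
  have hne : ∀ y, localShape E {w | F w y} ≠ fun _ => 0 := by
    intro y hy
    have h0 : {w | E w y}.encard ≠ 0 := encard_ne_zero.2 ⟨y, E.refl' y⟩
    have h1 := congrFun hy ⟨_, h0⟩
    rw [hshape, encard_eq_zero] at h1
    obtain ⟨t, ht, hty⟩ := hSex y
    have hyt : E t y := (hEe t y).2 hty
    refine (h1 ▸ notMem_empty t) ⟨⟨ht, ?_⟩, (hFf t y).1 (h.le hyt)⟩
    rw [mem_ofPred_eq]
    congr 1
    ext v
    exact ⟨fun h => E.trans' h hyt, fun h => E.trans' h (E.symm' hyt)⟩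
  refine ⟨T, inferInstance, hT.standardBorel, fun t => ⟨_, hne t⟩, ?_, ?_⟩
  · refine measurable_Sf_iff.2 fun m k => ?_
    simp only [hshape]
    exact measurable_subtype_coe
      (measurableSet_encard_fiber_eq hf hfc (hS.inter (hsize m.1)) k)
  · refine globalShape_eq_fiberCount Subtype.val (fun t t' htt' => ?_) (fun y => ?_) fun _ => rfl
    · exact Subtype.ext (hTinj t.2 t'.2 ((hFf _ _).1 htt'))
    · obtain ⟨t, ht, hty⟩ := hTex y
      exact ⟨⟨t, ht⟩, (hFf _ _).2 hty.symm⟩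

end Shapes

/-! ### The canonical realization -/

section Canonical

variable {X : Type u} {g : X → Sf}

/-- `ENat.toNat` sends `⊤` to `0`, a value left free since sizes are nonzero. Hence the fourth
coordinate of `B_g` is `s.1.toNat`, and its two cases merge into one. -/
theorem Size.toNat_injective : Function.Injective fun s : Size => s.1.toNat := by
  rintro ⟨s, hs⟩ ⟨t, ht⟩ h
  refine Subtype.ext ?_
  induction s using ENat.recTopCoe with
  | top => induction t using ENat.recTopCoe with
    | top => rfl
    | coe t => exact (ht (by simp_all [eq_comm])).elim
  | coe s => induction t using ENat.recTopCoe with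
    | top => exact (hs (by simp_all)).elim
    | coe t => simpa using h

theorem mem_canonSet {x : X} {k m n : ℕ} : (x, k, m, n) ∈ canonSet g ↔
    ∃ s : Size, n = s.1.toNat ∧ (k : ℕ∞) < s.1 ∧ (m : ℕ∞) < (g x).1 s := by
  constructor
  · rintro (⟨h0, hm⟩ | ⟨hk, hm⟩)
    · exact ⟨_, by simpa using h0, ENat.natCast_lt_top k, hm⟩
    · exact ⟨_, by simp, by simpa using hk, hm⟩
  · rintro ⟨⟨s, hs⟩, rfl, hk, hm⟩
    induction s using ENat.recTopCoe with
    | top => exact Or.inl ⟨by simp, hm⟩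
    | coe n => exact Or.inr ⟨by simpa using hk, hm⟩

theorem encard_setOf_natCast_lt (a : ℕ∞) : {m : ℕ | (m : ℕ∞) < a}.encard = a := by
  induction a using ENat.recTopCoe with
  | top => simp
  | coe n =>
    have : {m : ℕ | (m : ℕ∞) < n} = (Finset.range n : Set ℕ) := by ext; simp
    rw [this, encard_coe_eq_coe_finsetCard, Finset.card_range]

theorem canonE_iff {p q : canonSet g} : canonE g p q ↔
    p.1.1 = q.1.1 ∧ p.1.2.2.1 = q.1.2.2.1 ∧ p.1.2.2.2 = q.1.2.2.2 := by
  change (_, _, _) = (_, _, _) ↔ _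
  simp only [Prod.mk.injEq]

theorem canonF_iff {p q : canonSet g} : canonF g p q ↔ p.1.1 = q.1.1 := Iff.rfl

theorem measurableSet_canonSet [MeasurableSpace X] (hg : Measurable g) :
    MeasurableSet (canonSet g) := by
  have hlt : ∀ (m : ℕ) (s : Size), MeasurableSet {x | (m : ℕ∞) < (g x).1 s} := by
    intro m s
    have : Countable ℕ∞ := inferInstanceAs (Countable (Option ℕ))
    have : {x | (m : ℕ∞) < (g x).1 s} = ⋃ (a : ℕ∞) (_ : (m : ℕ∞) < a), {x | (g x).1 s = a} := by
      ext x
      simp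
    rw [this]
    exact MeasurableSet.iUnion fun a => MeasurableSet.iUnion fun _ => measurable_Sf_iff.1 hg s a
  have : canonSet g = ⋃ (q : ℕ × ℕ × ℕ), (⋃ (s : Size) (_ : q.2.2 = s.1.toNat)
      (_ : (q.1 : ℕ∞) < s.1), {x | (q.2.1 : ℕ∞) < (g x).1 s}) ×ˢ {q} := by
    ext ⟨x, k, m, n⟩
    simp [mem_canonSet, and_left_comm]
  rw [this]
  have : Countable Size := Size.toNat_injective.countable
  exact MeasurableSet.iUnion fun q => (MeasurableSet.iUnion fun s => MeasurableSet.iUnion fun _ =>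
    MeasurableSet.iUnion fun _ => hlt q.2.1 s).prod (measurableSet_singleton q)

theorem isSmoothCountablePair_canon [MeasurableSpace X] [StandardBorelSpace X] :
    IsSmoothCountablePair (canonE g) (canonF g) := by
  have hle : canonE g ≤ canonF g := fun _ _ h => canonF_iff.2 (canonE_iff.1 h).1
  have hF : IsCountable (canonF g) := by
    rintro _ ⟨q, rfl⟩
    refine countable_of_injective_of_countable_image (f := fun p : canonSet g => p.1.2) ?_
      (to_countable _)
    intro p hp p' hp' h
    exact Subtype.ext (Prod.ext (Eq.trans hp (Eq.symm hp')) h)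
  refine ⟨hle, ⟨X × ℕ × ℕ, inferInstance, inferInstance,
    fun p => (p.1.1, p.1.2.2.1, p.1.2.2.2), by fun_prop, fun _ _ => Iff.rfl⟩,
    ⟨X, inferInstance, inferInstance, fun p => p.1.1, by fun_prop, fun _ _ => Iff.rfl⟩, ?_, hF⟩
  rintro _ ⟨q, rfl⟩
  exact (hF _ ((canonF g).mem_classes q)).mono fun p hp => hle hp

theorem encard_canonE_class {p : canonSet g} {s : Size} (hs : p.1.2.2.2 = s.1.toNat) :
    {q | canonE g q p}.encard = s.1 := by
  obtain ⟨⟨x, k, m, n⟩, hp⟩ := p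
  obtain rfl : n = s.1.toNat := hs
  obtain ⟨s', hs', -, hm⟩ := mem_canonSet.1 hp
  obtain rfl := Size.toNat_injective hs'
  have hI : InjOn (fun q : canonSet g => q.1.2.1) {q | canonE g q ⟨(x, k, m, s.1.toNat), hp⟩} := by
    intro q hq q' hq' h
    obtain ⟨h1, h2, h3⟩ := canonE_iff.1 hq
    obtain ⟨h1', h2', h3'⟩ := canonE_iff.1 hq'
    exact Subtype.ext (Prod.ext (h1.trans h1'.symm) (Prod.ext h
      (Prod.ext (h2.trans h2'.symm) (h3.trans h3'.symm))))
  refine hI.encard_image.symm.trans (Eq.trans ?_ (encard_setOf_natCast_lt s.1))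
  congr 1
  ext l
  constructor
  · rintro ⟨⟨⟨x', k', m', n'⟩, hq⟩, hqp, rfl⟩
    obtain ⟨t, ht, hl, -⟩ := mem_canonSet.1 hq
    obtain rfl := Size.toNat_injective ((canonE_iff.1 hqp).2.2.symm.trans ht)
    exact hl
  · intro hl
    exact ⟨⟨(x, l, m, s.1.toNat), mem_canonSet.2 ⟨s, rfl, hl, hm⟩⟩, canonE_iff.2 ⟨rfl, rfl, rfl⟩,
      rfl⟩

theorem localShape_canon (p : canonSet g) :
    localShape (canonE g) {q | canonF g q p} = (g p.1.1).1 := by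
  funext s
  -- The points with `k = 0` represent the `E`-classes, since `0 < s`; they are counted by `m`.
  rw [localShape_eq (J := {q | q.1.1 = p.1.1 ∧ q.1.2.1 = 0 ∧ q.1.2.2.2 = s.1.toNat})]
  · have hI : InjOn (fun q : canonSet g => q.1.2.2.1)
        {q | q.1.1 = p.1.1 ∧ q.1.2.1 = 0 ∧ q.1.2.2.2 = s.1.toNat} := by
      rintro q ⟨h1, h2, h3⟩ q' ⟨h1', h2', h3'⟩ h
      exact Subtype.ext (Prod.ext (h1.trans h1'.symm) (Prod.ext (h2.trans h2'.symm)
        (Prod.ext h (h3.trans h3'.symm))))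
    refine hI.encard_image.symm.trans (Eq.trans ?_ (encard_setOf_natCast_lt ((g p.1.1).1 s)))
    congr 1
    ext m
    constructor
    · rintro ⟨⟨⟨x', k', m', n'⟩, hq⟩, ⟨h1, h2, h3⟩, rfl⟩
      obtain ⟨t, ht, -, hm⟩ := mem_canonSet.1 hq
      obtain rfl := Size.toNat_injective (h3.symm.trans ht)
      exact h1 ▸ hm
    · intro hm
      exact ⟨⟨(p.1.1, 0, m, s.1.toNat), mem_canonSet.2 ⟨s, rfl, pos_iff_ne_zero.2 s.2, hm⟩⟩,
        ⟨rfl, rfl, rfl⟩, rfl⟩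
  · intro x hx y hyx
    exact (canonE_iff.1 hyx).1.trans hx
  · exact fun q hq => hq.1
  · exact fun q hq => encard_canonE_class hq.2.2
  · rintro q ⟨h1, h2, h3⟩ q' ⟨h1', h2', h3'⟩ h
    exact Subtype.ext (Prod.ext (h1.trans h1'.symm) (Prod.ext (h2.trans h2'.symm)
      (Prod.ext (canonE_iff.1 h).2.1 (h3.trans h3'.symm))))
  · rintro ⟨⟨x, k, m, n⟩, hq⟩ hqp hs
    obtain ⟨t, ht, hk, hm⟩ := mem_canonSet.1 hq
    have hts := (encard_canonE_class (p := ⟨(x, k, m, n), hq⟩) ht).symm.trans hs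
    obtain rfl := Subtype.ext hts
    exact ⟨⟨(x, 0, m, n), mem_canonSet.2 ⟨t, ht, pos_iff_ne_zero.2 t.2, hm⟩⟩,
      ⟨hqp, rfl, ht⟩, canonE_iff.2 ⟨rfl, rfl, rfl⟩⟩

theorem globalShape_canon (α : Sf) :
    globalShape (canonE g) (canonF g) α = fiberCount g α := by
  -- No `x` is lost, because `g x` is not constantly zero.
  have hex : ∀ x, ∃ p : canonSet g, p.1.1 = x := by
    intro x
    obtain ⟨s, hs⟩ := Function.ne_iff.1 (g x).2
    exact ⟨⟨(x, 0, 0, s.1.toNat), mem_canonSet.2 ⟨s, rfl, pos_iff_ne_zero.2 s.2,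
      pos_iff_ne_zero.2 hs⟩⟩, rfl⟩
  choose c hc using hex
  refine globalShape_eq_fiberCount c (fun x x' h => ?_) (fun y => ⟨y.1.1, ?_⟩) (fun x => ?_) α
  · rw [← hc x, ← hc x']
    exact h
  · exact (hc _).symm
  · rw [localShape_canon, hc]

end Canonical

end FineShape

theorem lemma6p1 :
    -- global fine shapes and fiber-counting functions take values in `cardC`
    (∀ (Y : Type u) [MeasurableSpace Y] [StandardBorelSpace Y] (E F : Setoid Y),
      FineShape.IsSmoothCountablePair E F → ∀ α, FineShape.globalShape E F α ∈ FineShape.cardC) ∧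
    (∀ (X : Type u) [MeasurableSpace X] [StandardBorelSpace X] (g : X → FineShape.Sf),
      Measurable g → ∀ α, FineShape.fiberCount g α ∈ FineShape.cardC) ∧
    -- the characterization of global fine shapes
    (∀ φ : FineShape.Sf → FineShape.cardC.{u},
      (∃ (Y : Type u) (_ : MeasurableSpace Y) (_ : StandardBorelSpace Y) (E F : Setoid Y),
        FineShape.IsSmoothCountablePair E F ∧
          ∀ α, FineShape.globalShape E F α = (φ α : Cardinal.{u})) ↔
      (∃ (X : Type u) (_ : MeasurableSpace X) (_ : StandardBorelSpace X) (g : X → FineShape.Sf),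
        Measurable g ∧ ∀ α, FineShape.fiberCount g α = (φ α : Cardinal.{u}))) ∧
    -- the canonical realization; a measurable subset of a standard Borel space is standard Borel
    (∀ (X : Type u) [MeasurableSpace X] [StandardBorelSpace X] (g : X → FineShape.Sf),
      Measurable g →
        MeasurableSet (FineShape.canonSet g) ∧
        FineShape.IsSmoothCountablePair (FineShape.canonE g) (FineShape.canonF g) ∧
        ∀ α, FineShape.globalShape (FineShape.canonE g) (FineShape.canonF g) α =
          FineShape.fiberCount g α) := by
  refine ⟨fun Y _ _ E F h α => ?_, fun X _ _ g hg α => FineShape.fiberCount_mem_cardC hg α,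
    fun φ => ⟨?_, ?_⟩, fun X _ _ g hg => ⟨FineShape.measurableSet_canonSet hg,
      FineShape.isSmoothCountablePair_canon, FineShape.globalShape_canon⟩⟩
  · obtain ⟨X, _, _, g, hg, hgα⟩ := h.exists_fiberCount
    exact hgα α ▸ FineShape.fiberCount_mem_cardC hg α
  · rintro ⟨Y, _, _, E, F, h, hφ⟩
    obtain ⟨X, mX, sX, g, hg, hgα⟩ := h.exists_fiberCount
    exact ⟨X, mX, sX, g, hg, fun α => (hgα α).symm.trans (hφ α)⟩
  · rintro ⟨X, _, _, g, hg, hφ⟩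
    exact ⟨FineShape.canonSet g, inferInstance,
      (FineShape.measurableSet_canonSet hg).standardBorel, FineShape.canonE g,
      FineShape.canonF g, FineShape.isSmoothCountablePair_canon,
      fun α => (FineShape.globalShape_canon α).trans (hφ α)⟩
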